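/- Let $n\ge 1$ be an integer. A $C^*$-algebra (not necessarily unital) is called *$n$-homogeneous* if each of its nonzero irreducible representations (on a complex Hilbert space) is $n$-dimensional. Let $\mathcal{A}$ be a $C^*$-algebra and let $\mathbf{x}=(x_1,\ldots,x_k)$ be a finite system of elements of $\mathcal{A}$ that is $n$-homogeneous, i.e. the (not necessarily unital) $C^*$-subalgebra $C^*(\mathbf{x})$ of $\mathcal{A}$ generated by $x_1,\ldots,x_k$ is $n$-homogeneous. Let $M_n$ be the $C^*$-algebra of complex $n\times n$ matrices, and let $\mathfrak{U}_n$ be the group of unitary $n\times n$ matrices modulo the scalar ones $\{zI: |z|=1\}$; it acts on $M_n$ by $\mathfrak{u}.A=UAU^{-1}$, where $U$ represents $\mathfrak{u}$. Put $$\sigma_n(\mathbf{x})=\{(\pi(x_1),\ldots,\pi(x_k)) : \pi\colon C^*(\mathbf{x})\to M_n \text{ a nonzero } {*}\text{-homomorphism}\}\subset (M_n)^k,$$ with the topology inherited from $(M_n)^k$ and the coordinatewise action of $\mathfrak{U}_n$, and let $C^*(\sigma_n(\mathbf{x}),.)$ be the $C^*$-algebra of all continuous functions $f\colon\sigma_n(\mathbf{x})\to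 M_n$ that vanish at infinity and satisfy $f(\mathfrak{u}.a)=\mathfrak{u}.f(a)$ for all $\mathfrak{u}\in\mathfrak{U}_n$ and $a\in\sigma_n(\mathbf{x})$ (with pointwise operations and the supremum norm). The coordinate projections $p_j\colon\sigma_n(\mathbf{x})\ni(A_1,\ldots,A_k)\mapsto A_j\in M_n$ belong to this algebra. Then there is a unique $*$-homomorphism $$\Phi_{\mathbf{x}}\colon C^*(\sigma_n(\mathbf{x}),.)\to C^*(\mathbf{x})$$ such that $\Phi_{\mathbf{x}}(p_j)=x_j$ for $j=1,\ldots,k$. Moreover, $\Phi_{\mathbf{x}}$ is a $*$-isomorphism of $C^*$-algebras, i.e. it is bijective and isometric. -/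

import Mathlib

open scoped Matrix.Norms.L2Operator

universe u

noncomputable section

namespace NHomogeneous

/-- The `C*`-algebra `M_n` of complex `n × n` matrices (with the operator norm). -/
abbrev Mat (n : ℕ) : Type := Matrix (Fin n) (Fin n) ℂ

/-! ### The group of unitary matrices modulo scalars and its action on matrices -/

/-- The normal subgroup `𝕋 · I` of the unitary group of `M_n`. -/
def scalarUnitaries (n : ℕ) : Subgroup (unitary (Mat n)) where
  carrier := {U | ∃ z : ℂ, ‖z‖ = 1 ∧ (U : Mat n) = z • (1 : Mat n)}
  one_mem' := ⟨1, by simp, by simp⟩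
  mul_mem' := by
    rintro U V ⟨z, hz, hU⟩ ⟨w, hw, hV⟩
    refine ⟨z * w, by simp [hz, hw], ?_⟩
    simp [hU, hV, smul_smul, mul_comm]
  inv_mem' := by
    rintro U ⟨z, hz, hU⟩
    refine ⟨star z, by simp [hz], ?_⟩
    rw [← Unitary.star_eq_inv, Unitary.coe_star, hU]
    simp

instance (n : ℕ) : (scalarUnitaries n).Normal where
  conj_mem := by
    rintro U ⟨z, hz, hU⟩ V
    refine ⟨z, hz, ?_⟩
    have h : ((V * U * V⁻¹ : unitary (Mat n)) : Mat n) = (V : Mat n) * U * star (V : Mat n) := by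
      rw [← Unitary.star_eq_inv]; rfl
    rw [h, hU]
    simp

/-- The group of unitary `n × n` matrices modulo `𝕋 · I`. -/
def PU (n : ℕ) : Type := unitary (Mat n) ⧸ scalarUnitaries n

instance (n : ℕ) : Group (PU n) := inferInstanceAs (Group (unitary (Mat n) ⧸ scalarUnitaries n))

/-- The class of a unitary matrix. -/
def PU.mk {n : ℕ} : unitary (Mat n) →* PU n := QuotientGroup.mk' (scalarUnitaries n)

/-- The homomorphism sending the class of `U` to the automorphism `A ↦ U A U⁻¹` of `M_n`. -/
def PU.conj (n : ℕ) : PU n →* (Mat n ≃⋆ₐ[ℂ] Mat n) :=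
  QuotientGroup.lift (scalarUnitaries n) (Unitary.conjStarAlgAut ℂ (Mat n)) <| by
    rintro U ⟨z, hz, hU⟩
    ext1 A
    have hz' : z * star z = 1 := by
      rw [Complex.star_def, Complex.mul_conj, Complex.normSq_eq_norm_sq, hz]; simp
    simp only [Unitary.conjStarAlgAut_apply, hU]
    simp only [star_smul, star_one, smul_mul_assoc, one_mul, mul_smul_comm, mul_one, smul_smul]
    rw [mul_comm, hz', one_smul]
    rfl

/-- The action `u.A = U A U⁻¹` on matrices, where `u` is the class of `U`. -/
instance (n : ℕ) : MulAction (PU n) (Mat n) where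
  smul u A := PU.conj n u A
  one_smul A := by change PU.conj n 1 A = A; rw [map_one]; rfl
  mul_smul u v A := by
    change PU.conj n (u * v) A = PU.conj n u (PU.conj n v A); rw [map_mul]; rfl

theorem PU.smul_def {n : ℕ} (u : PU n) (A : Mat n) : u • A = PU.conj n u A := rfl

theorem PU.mk_smul {n : ℕ} (U : unitary (Mat n)) (A : Mat n) :
    PU.mk U • A = (U : Mat n) * A * star (U : Mat n) := rfl

/-! ### The algebra of equivariant maps -/

/-- For a space `X` on which the group `PU n` acts, `C*(X,.)` is the algebra of all continuous
`f : X → M_n` which vanish at infinity and satisfy `f (u.x) = u.f(x)`. -/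
def equivariantC0 (n : ℕ) (X : Type*) [TopologicalSpace X] [MulAction (PU n) X] :
    NonUnitalStarSubalgebra ℂ (ZeroAtInftyContinuousMap X (Mat n)) where
  carrier := {f | ∀ (u : PU n) (x : X), f (u • x) = u • f x}
  add_mem' := by
    intro f g hf hg u x
    simp only [ZeroAtInftyContinuousMap.add_apply, hf u x, hg u x, PU.smul_def, map_add]
  zero_mem' := by
    intro u x
    simp only [ZeroAtInftyContinuousMap.zero_apply, PU.smul_def, map_zero]
  mul_mem' := by
    intro f g hf hg u x
    simp only [ZeroAtInftyContinuousMap.mul_apply, hf u x, hg u x, PU.smul_def, map_mul]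
  smul_mem' := by
    intro c f hf u x
    simp only [ZeroAtInftyContinuousMap.smul_apply, hf u x, PU.smul_def, map_smul]
  star_mem' := by
    intro f hf u x
    simp only [ZeroAtInftyContinuousMap.star_apply, hf u x, PU.smul_def, map_star]

/-- `C*(X,.)` is closed in `C₀(X, M_n)`, hence a `C*`-algebra. -/
instance (n : ℕ) (X : Type*) [TopologicalSpace X] [MulAction (PU n) X] :
    IsClosed (equivariantC0 n X : Set (ZeroAtInftyContinuousMap X (Mat n))) := by
  have hc : ∀ x : X, Continuous fun f : ZeroAtInftyContinuousMap X (Mat n) => f x := fun x =>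
    (continuous_eval_const (F := BoundedContinuousFunction X (Mat n)) x).comp
      ZeroAtInftyContinuousMap.isometry_toBCF.continuous
  have h : (equivariantC0 n X : Set (ZeroAtInftyContinuousMap X (Mat n))) =
      ⋂ u : PU n, ⋂ x : X, {f | f (u • x) = u • f x} := by
    ext f
    simp only [Set.mem_iInter]
    rfl
  rw [h]
  refine isClosed_iInter fun u => isClosed_iInter fun x => isClosed_eq (hc _) ?_
  obtain ⟨U, rfl⟩ := QuotientGroup.mk'_surjective _ u
  change Continuous fun f : ZeroAtInftyContinuousMap X (Mat n) =>
    (U : Mat n) * f x * star (U : Mat n)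
  exact (continuous_const.mul (hc x)).mul continuous_const

/-! ### Representations and homogeneous `C*`-algebras -/

/-- A representation on a Hilbert space is irreducible if the only closed invariant subspaces are
the trivial ones. -/
def IsIrreducibleRep {B : Type*} [NonUnitalCStarAlgebra B] {H : Type*} [NormedAddCommGroup H]
    [InnerProductSpace ℂ H] [CompleteSpace H] (π : B →⋆ₙₐ[ℂ] (H →L[ℂ] H)) : Prop :=
  ∀ W : Submodule ℂ H, IsClosed (W : Set H) → (∀ b : B, ∀ v ∈ W, π b v ∈ W) → W = ⊥ ∨ W = ⊤

/-- A `C*`-algebra is `n`-homogeneous if each of its nonzero irreducible representations is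
`n`-dimensional. (Irreducible representations are cyclic, so up to unitary equivalence they
all act on Hilbert spaces in the universe of the algebra.) -/
def IsHomogeneous (n : ℕ) (B : Type u) [NonUnitalCStarAlgebra B] : Prop :=
  ∀ (H : Type u) [NormedAddCommGroup H] [InnerProductSpace ℂ H] [CompleteSpace H]
    (π : B →⋆ₙₐ[ℂ] (H →L[ℂ] H)), π ≠ 0 → IsIrreducibleRep π → Module.rank ℂ H = (n : Cardinal)

section System

variable {A : Type u} [NonUnitalCStarAlgebra A] {k : ℕ}

/-- `C*(x_1, …, x_k)`, the (not necessarily unital) `C*`-subalgebra generated by the system. -/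
def generated (x : Fin k → A) : NonUnitalStarSubalgebra ℂ A :=
  (NonUnitalStarAlgebra.adjoin ℂ (Set.range x)).topologicalClosure

instance (x : Fin k → A) : IsClosed (generated x : Set A) :=
  NonUnitalStarSubalgebra.isClosed_topologicalClosure _

/-- The generator `x_j`, as an element of `C*(x_1, …, x_k)`. -/
def gen (x : Fin k → A) (j : Fin k) : generated x :=
  ⟨x j, NonUnitalStarSubalgebra.le_topologicalClosure _
    (NonUnitalStarAlgebra.subset_adjoin ℂ _ (Set.mem_range_self j))⟩

/-- The system `x` is `n`-homogeneous if the `C*`-algebra it generates is. -/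
def IsHomogeneousSystem (n : ℕ) (x : Fin k → A) : Prop :=
  IsHomogeneous n (generated x)

/-- The `n`-spectrum `σ_n(x)`: all tuples `(π(x_1), …, π(x_k))`, where `π` is a nonzero
representation of `C*(x_1, …, x_k)` in `M_n`. -/
def nSpectrum (n : ℕ) (x : Fin k → A) : Set (Fin k → Mat n) :=
  {a | ∃ π : generated x →⋆ₙₐ[ℂ] Mat n, π ≠ 0 ∧ a = fun j => π (gen x j)}

theorem smul_mem_nSpectrum {n : ℕ} {x : Fin k → A} (u : PU n) {a : Fin k → Mat n}
    (ha : a ∈ nSpectrum n x) : u • a ∈ nSpectrum n x := by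
  obtain ⟨π, hπ, rfl⟩ := ha
  refine ⟨NonUnitalStarAlgHom.comp
    ((PU.conj n u : Mat n ≃⋆ₐ[ℂ] Mat n) : Mat n →⋆ₙₐ[ℂ] Mat n) π, ?_, rfl⟩
  intro h
  apply hπ
  ext1 b
  have hb : PU.conj n u (π b) = 0 := DFunLike.congr_fun h b
  exact (map_eq_zero_iff _ (PU.conj n u).injective).1 hb

/-- The action `u.(A_1, …, A_k) = (u.A_1, …, u.A_k)` on `σ_n(x)`. -/
instance (n : ℕ) (x : Fin k → A) : MulAction (PU n) (nSpectrum n x) where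
  smul u a := ⟨u • (a : Fin k → Mat n), smul_mem_nSpectrum u a.2⟩
  one_smul _ := Subtype.ext (one_smul _ _)
  mul_smul _ _ _ := Subtype.ext (mul_smul _ _ _)

theorem coe_smul_nSpectrum {n : ℕ} {x : Fin k → A} (u : PU n) (a : nSpectrum n x) (j : Fin k) :
    ((u • a : nSpectrum n x) : Fin k → Mat n) j = u • (a : Fin k → Mat n) j := rfl

/-- Together with the zero tuple the `n`-spectrum is compact. -/
theorem isCompact_insert_nSpectrum (n : ℕ) (x : Fin k → A) :
    IsCompact (insert 0 (nSpectrum n x)) := by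
  have : ProperSpace (Mat n) := FiniteDimensional.proper ℂ _
  let K : Set (generated x → Mat n) := Set.univ.pi fun b => Metric.closedBall 0 ‖b‖
  have hK : IsCompact K := isCompact_univ_pi fun b => isCompact_closedBall _ _
  let R : Set (generated x → Mat n) :=
    {F | (∀ b c, F (b + c) = F b + F c) ∧ (∀ b c, F (b * c) = F b * F c) ∧
      (∀ (z : ℂ) b, F (z • b) = z • F b) ∧ ∀ b, F (star b) = star (F b)}
  have hR : IsClosed R := by
    have h1 : IsClosed {F : generated x → Mat n | ∀ b c, F (b + c) = F b + F c} := by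
      simp only [Set.ofPred_forall]
      exact isClosed_iInter fun b => isClosed_iInter fun c => isClosed_eq
        (continuous_apply _) ((continuous_apply b).add (continuous_apply c))
    have h2 : IsClosed {F : generated x → Mat n | ∀ b c, F (b * c) = F b * F c} := by
      simp only [Set.ofPred_forall]
      exact isClosed_iInter fun b => isClosed_iInter fun c => isClosed_eq
        (continuous_apply _) ((continuous_apply b).mul (continuous_apply c))
    have h3 : IsClosed {F : generated x → Mat n | ∀ (z : ℂ) b, F (z • b) = z • F b} := by
      simp only [Set.ofPred_forall]
      exact isClosed_iInter fun z => isClosed_iInter fun b => isClosed_eq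
        (continuous_apply _) ((continuous_apply b).const_smul z)
    have h4 : IsClosed {F : generated x → Mat n | ∀ b, F (star b) = star (F b)} := by
      simp only [Set.ofPred_forall]
      exact isClosed_iInter fun b => isClosed_eq
        (continuous_apply _) ((continuous_apply b).star)
    exact h1.inter (h2.inter (h3.inter h4))
  have hmap : Continuous fun F : generated x → Mat n => fun j => F (gen x j) :=
    continuous_pi fun j => continuous_apply _
  convert (hK.inter_right hR).image hmap using 1
  ext a
  constructor
  · intro ha
    have key : ∀ π : generated x →⋆ₙₐ[ℂ] Mat n, (fun b => π b) ∈ K ∩ R := fun π =>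
      ⟨fun b _ => by simpa using NonUnitalStarAlgHom.norm_apply_le π b,
        map_add π, map_mul π, map_smul π, map_star π⟩
    rcases ha with rfl | ⟨π, -, rfl⟩
    · exact ⟨_, key 0, rfl⟩
    · exact ⟨_, key π, rfl⟩
  · rintro ⟨F, ⟨-, hadd, hmul, hsmul, hstar⟩, rfl⟩
    let π : generated x →⋆ₙₐ[ℂ] Mat n :=
      { toFun := F
        map_add' := hadd
        map_mul' := hmul
        map_smul' := hsmul
        map_zero' := by simpa using hsmul 0 0
        map_star' := hstar }
    by_cases h : π = 0
    · left
      funext j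
      exact DFunLike.congr_fun h (gen x j)
    · exact Or.inr ⟨π, h, rfl⟩

/-- The coordinate projection `p_j : (A_1, …, A_k) ↦ A_j`, as an element of `C*(σ_n(x),.)`. -/
def coordProj (n : ℕ) (x : Fin k → A) (j : Fin k) : equivariantC0 n (nSpectrum n x) :=
  ⟨{ toFun := fun a => (a : Fin k → Mat n) j
     continuous_toFun := (continuous_apply j).comp continuous_subtype_val
     zero_at_infty' := by
      rw [(Metric.nhds_basis_ball (x := (0 : Mat n))).tendsto_right_iff]
      intro ε hε
      rw [Filter.Eventually, Filter.mem_cocompact]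
      let C : Set (Fin k → Mat n) := {a | ε ≤ ‖a j‖}
      have hC : IsClosed C := isClosed_le continuous_const (continuous_apply j).norm
      have hsub : insert 0 (nSpectrum n x) ∩ C ⊆ nSpectrum n x := by
        rintro a ⟨rfl | ha, haC⟩
        · exact absurd haC (by simpa [C] using hε)
        · exact ha
      refine ⟨Subtype.val ⁻¹' (insert 0 (nSpectrum n x) ∩ C), ?_, ?_⟩
      · rw [Topology.IsInducing.subtypeVal.isCompact_iff, Subtype.image_preimage_coe,
          Set.inter_eq_right.2 hsub]
        exact (isCompact_insert_nSpectrum n x).inter_right hC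
      · intro a ha
        by_contra hn
        refine ha ⟨Or.inr a.2, ?_⟩
        simpa [C] using hn },
    fun u a => coe_smul_nSpectrum u a j⟩

end System

end NHomogeneous

end

/-! A point `a` of the `n`-spectrum determines a representation `repAt a`, because a
`*`-homomorphism is continuous and hence fixed by its values on the generators. The inverse of the
desired map is the Gelfand transform `gelfand`, sending `b` to the function `a ↦ repAt a b`; it
sends the generators to the coordinate projections.

It is injective, hence isometric, because irreducible representations separate points (Krein–Milman
for states together with GNS, `exists_irreducible_apply_ne_zero`) and by homogeneity the nonzero
ones live on `n`-dimensional spaces.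

It is onto by a Stone–Weierstrass argument. Every nonzero representation in `M_n` is surjective
(`IsHomogeneous.surjective`), and two such representations are either unitarily conjugate or
separated by an element going to 1 and to 0 (`exists_smul_eq_or_exists_separating`). Equivariance
handles the first case, so local interpolants of `f` can be glued by a matrix-valued partition of
unity (`exists_uniform_approx`). The range is dense, and closed by isometry.

Any `Φ` sending projections to generators is a left inverse of this bijection, which gives
uniqueness. -/

noncomputable section

namespace NHomogeneous

/-! ### Pure states and separation of points by irreducible representations. -/

section States

open scoped ComplexOrder InnerProductSpace

variable {U : Type u} [CStarAlgebra U] [PartialOrder U] [StarOrderedRing U]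

variable (U) in
/-- The states of a unital `C*`-algebra, as a set of functions. -/
def stateSet : Set (U → ℂ) :=
  {φ | (∀ a b, φ (a + b) = φ a + φ b) ∧ (∀ (z : ℂ) a, φ (z • a) = z * φ a) ∧
    (∀ a, 0 ≤ a → 0 ≤ φ a) ∧ φ 1 = 1}

/-- A state as a positive linear functional. -/
def stateFunctional {φ : U → ℂ} (hφ : φ ∈ stateSet U) : U →ₚ[ℂ] ℂ :=
  .mk₀ { toFun := φ, map_add' := hφ.1, map_smul' := hφ.2.1 } hφ.2.2.1

/-- The canonical cyclic vector of the GNS representation. -/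
def gnsVector (f : U →ₚ[ℂ] ℂ) : f.GNS := ((f.toPreGNS 1 : f.PreGNS) : f.GNS)

theorem gns_apply_gnsVector (f : U →ₚ[ℂ] ℂ) (a : U) :
    f.gnsNonUnitalStarAlgHom a (gnsVector f) = ((f.toPreGNS a : f.PreGNS) : f.GNS) := by
  simp [gnsVector]

theorem inner_gns_gnsVector (f : U →ₚ[ℂ] ℂ) (a : U) :
    ⟪gnsVector f, f.gnsNonUnitalStarAlgHom a (gnsVector f)⟫_ℂ = f a := by
  rw [gns_apply_gnsVector, gnsVector, UniformSpace.Completion.inner_coe,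
    PositiveLinearMap.preGNS_inner_def]
  simp

theorem norm_gnsVector (f : U →ₚ[ℂ] ℂ) (hf : f 1 = 1) : ‖gnsVector f‖ = 1 := by
  rw [gnsVector, UniformSpace.Completion.norm_coe, PositiveLinearMap.preGNS_norm_def]
  simp [hf]

/-- A state is the vector functional of a unit vector in its GNS representation, which is
contractive. -/
theorem norm_state_apply_le {φ : U → ℂ} (hφ : φ ∈ stateSet U) (a : U) : ‖φ a‖ ≤ ‖a‖ := by
  set f := stateFunctional hφ
  have h1 : ‖gnsVector f‖ = 1 := norm_gnsVector f hφ.2.2.2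
  calc ‖φ a‖ = ‖⟪gnsVector f, f.gnsNonUnitalStarAlgHom a (gnsVector f)⟫_ℂ‖ := by
        rw [inner_gns_gnsVector]; rfl
    _ ≤ ‖gnsVector f‖ * ‖f.gnsNonUnitalStarAlgHom a (gnsVector f)‖ := norm_inner_le_norm _ _
    _ ≤ ‖gnsVector f‖ * (‖f.gnsNonUnitalStarAlgHom a‖ * ‖gnsVector f‖) := by
        gcongr; exact ContinuousLinearMap.le_opNorm _ _
    _ = ‖f.gnsNonUnitalStarAlgHom a‖ := by rw [h1]; ring
    _ ≤ ‖a‖ := NonUnitalStarAlgHom.norm_apply_le _ a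

/-- Tychonoff: in the topology of pointwise convergence the states form a closed subset of a product
of discs. -/
theorem isCompact_stateSet : IsCompact (stateSet U) := by
  have hK : IsCompact (Set.univ.pi fun a : U => Metric.closedBall (0 : ℂ) ‖a‖) :=
    isCompact_univ_pi fun a => isCompact_closedBall _ _
  refine hK.of_isClosed_subset ?_ fun φ hφ a _ => by simpa using norm_state_apply_le hφ a
  have h1 : IsClosed {φ : U → ℂ | ∀ a b, φ (a + b) = φ a + φ b} := by
    simp only [Set.ofPred_forall]
    exact isClosed_iInter fun a => isClosed_iInter fun b => isClosed_eq
      (continuous_apply _) ((continuous_apply a).add (continuous_apply b))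
  have h2 : IsClosed {φ : U → ℂ | ∀ (z : ℂ) a, φ (z • a) = z * φ a} := by
    simp only [Set.ofPred_forall]
    exact isClosed_iInter fun z => isClosed_iInter fun b => isClosed_eq
      (continuous_apply _) (continuous_const.mul (continuous_apply b))
  have h3 : IsClosed {φ : U → ℂ | ∀ a, 0 ≤ a → 0 ≤ φ a} := by
    simp only [Set.ofPred_forall]
    exact isClosed_iInter fun a => isClosed_iInter fun _ =>
      isClosed_le continuous_const (continuous_apply a)
  have h4 : IsClosed {φ : U → ℂ | φ 1 = 1} :=
    isClosed_eq (continuous_apply _) continuous_const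
  exact h1.inter (h2.inter (h3.inter h4))

omit [StarOrderedRing U] in
theorem convex_stateSet : Convex ℝ (stateSet U) := by
  rintro φ ⟨h1, h2, h3, h4⟩ ψ ⟨k1, k2, k3, k4⟩ s t hs ht hst
  refine ⟨fun a b => ?_, fun z a => ?_, fun a ha => ?_, ?_⟩
  · simp [h1, k1]; ring
  · simp [h2, k2]; ring
  · have hs' : (0 : ℂ) ≤ s := by exact_mod_cast hs
    have ht' : (0 : ℂ) ≤ t := by exact_mod_cast ht
    simpa using add_nonneg (mul_nonneg hs' (h3 a ha)) (mul_nonneg ht' (k3 a ha))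
  · simp [h4, k4]; exact_mod_cast hst

/-- Hahn–Banach separates `-c` from the closed cone of positive elements. The resulting real
functional is extended complex-linearly through real and imaginary parts, then normalised at 1. -/
theorem exists_state_apply_ne_zero {c : U} (hc : 0 ≤ c) (hc0 : c ≠ 0) :
    ∃ φ ∈ stateSet U, φ c ≠ 0 := by
  let C : ProperCone ℝ U :=
    { carrier := {a | 0 ≤ a}
      add_mem' := fun ha hb => add_nonneg ha hb
      zero_mem' := le_rfl
      smul_mem' := fun r a ha => smul_nonneg r.2 ha
      isClosed' := isClosed_Ici }
  have hcC : -c ∉ C := fun h => hc0 (le_antisymm (neg_nonneg.1 h) hc)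
  obtain ⟨f, hf, hfc⟩ := C.hyperplane_separation_point hcC
  let φ : U → ℂ := fun a => (f (realPart a : U) : ℂ) + Complex.I * (f (imaginaryPart a : U) : ℂ)
  have hsa : ∀ a : U, 0 ≤ a → φ a = (f a : ℂ) := fun a ha => by
    have ha' : IsSelfAdjoint a := .of_nonneg ha
    simp [φ, ha'.coe_realPart, ha'.imaginaryPart]
  have hadd : ∀ a b, φ (a + b) = φ a + φ b := fun a b => by
    simp [φ]; ring
  have hsmul : ∀ (z : ℂ) a, φ (z • a) = z * φ a := fun z a => by
    apply Complex.ext <;> simp [φ, realPart_smul, imaginaryPart_smul]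
  have hnn : ∀ a, 0 ≤ a → 0 ≤ φ a := fun a ha => by
    rw [hsa a ha]; exact_mod_cast hf a ha
  have hφc : φ c ≠ 0 := by
    rw [hsa c hc]
    have : 0 < f c := by simpa using hfc
    exact_mod_cast this.ne'
  let F : U →ₚ[ℂ] ℂ := .mk₀ { toFun := φ, map_add' := hadd, map_smul' := hsmul } hnn
  have h1 : φ 1 ≠ 0 := by
    intro h
    have := F.norm_apply_le_of_nonneg c hc
    have h' : F 1 = 0 := h
    rw [h'] at this
    rw [norm_zero, zero_mul] at this
    exact hφc (norm_le_zero_iff.1 this)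
  have h1' : 0 ≤ φ 1 := hnn 1 zero_le_one
  refine ⟨fun a => (φ 1)⁻¹ * φ a, ⟨fun a b => ?_, fun z a => ?_, fun a ha => ?_, ?_⟩, ?_⟩
  · simp only [hadd]; ring
  · simp only [hsmul]; ring
  · exact mul_nonneg (inv_nonneg.2 h1') (hnn a ha)
  · exact inv_mul_cancel₀ h1
  · exact mul_ne_zero (inv_ne_zero h1) hφc

/-- Krein–Milman: the functions vanishing at `c` form a closed convex set, so if it contained all
extreme states it would contain every state. -/
theorem exists_extreme_state_apply_ne_zero {c : U} (hc : 0 ≤ c) (hc0 : c ≠ 0) :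
    ∃ φ ∈ (stateSet U).extremePoints ℝ, φ c ≠ 0 := by
  by_contra! h
  obtain ⟨φ, hφ, hφc⟩ := exists_state_apply_ne_zero hc hc0
  apply hφc
  have hcl : IsClosed {ψ : U → ℂ | ψ c = 0} := isClosed_eq (continuous_apply _) continuous_const
  have hcv : Convex ℝ {ψ : U → ℂ | ψ c = 0} := by
    intro ψ (hψ : ψ c = 0) χ (hχ : χ c = 0) s t _ _ _
    change (s • ψ + t • χ) c = 0
    simp [hψ, hχ]
  rw [← closure_convexHull_extremePoints isCompact_stateSet convex_stateSet] at hφ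
  exact closure_minimal (convexHull_min h hcv) hcl hφ

theorem invariant_orthogonal {B : Type*} [NonUnitalCStarAlgebra B] {H : Type*}
    [NormedAddCommGroup H] [InnerProductSpace ℂ H] [CompleteSpace H] (π : B →⋆ₙₐ[ℂ] (H →L[ℂ] H))
    (W : Submodule ℂ H) (hW : ∀ b : B, ∀ v ∈ W, π b v ∈ W) (b : B) (v : H) (hv : v ∈ Wᗮ) : π b v ∈ Wᗮ := by
  rw [Submodule.mem_orthogonal] at hv ⊢
  intro w hw
  have := hv _ (hW (star b) w hw)
  rwa [map_star, ContinuousLinearMap.star_eq_adjoint, ContinuousLinearMap.adjoint_inner_left]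
    at this

/-- The orthogonal projection onto an invariant subspace commutes with the representation. -/
theorem starProjection_commute {B : Type*} [NonUnitalCStarAlgebra B] {H : Type*}
    [NormedAddCommGroup H] [InnerProductSpace ℂ H] [CompleteSpace H] (π : B →⋆ₙₐ[ℂ] (H →L[ℂ] H))
    (W : Submodule ℂ H) [W.HasOrthogonalProjection] (hW : ∀ b : B, ∀ v ∈ W, π b v ∈ W)
    (b : B) (v : H) : W.starProjection (π b v) = π b (W.starProjection v) := by
  refine Submodule.eq_starProjection_of_mem_orthogonal' (z := π b (v - W.starProjection v))
    (hW b _ (Submodule.starProjection_apply_mem W v))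
    (invariant_orthogonal π W hW b _ (Submodule.sub_starProjection_mem_orthogonal v)) ?_ |>.symm ▸ rfl
  rw [← map_add]; simp

/-- The projection `P` onto `W` commutes with `π`, so `f` is the convex combination, with weight `t
= ‖P ξ‖ ^ 2`, of the vector states of `P ξ` and `ξ - P ξ`. If `t` is 0 or 1, cyclicity of `ξ` gives
`P = 0` or `P = 1`. Otherwise extremality forces `P ξ = t ξ`, and then `t ^ 2 = t`, which is absurd.
-/
theorem gns_invariant_of_extreme {f : U →ₚ[ℂ] ℂ} (hf : ⇑f ∈ (stateSet U).extremePoints ℝ)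
    (W : Submodule ℂ f.GNS) (hcl : IsClosed (W : Set f.GNS))
    (hW : ∀ (b : U), ∀ v ∈ W, f.gnsNonUnitalStarAlgHom b v ∈ W) :
    W = ⊥ ∨ W = ⊤ := by
  set π := f.gnsNonUnitalStarAlgHom with hπ
  set ξ := gnsVector f with hξ
  have : CompleteSpace W := hcl.completeSpace_coe
  set P := W.starProjection with hP
  have hcomm : ∀ b v, P (π b v) = π b (P v) := starProjection_commute π W hW
  have hPP : ∀ v, P (P v) = P v := fun v =>
    Submodule.starProjection_eq_self_iff.2 (Submodule.starProjection_apply_mem W v)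
  have hdense : ∀ T S : f.GNS →L[ℂ] f.GNS, (∀ b, T (π b ξ) = S (π b ξ)) → T = S := by
    intro T S h
    ext v
    induction v using UniformSpace.Completion.induction_on with
    | hp => exact isClosed_eq T.continuous S.continuous
    | ih a =>
      have := h (f.ofPreGNS a)
      rw [gns_apply_gnsVector] at this
      simpa using this
  have hself : ∀ v w : f.GNS, ⟪P v, w⟫_ℂ = ⟪v, P w⟫_ℂ := fun v w =>
    Submodule.inner_starProjection_left_eq_right W v w
  have hinner : ∀ b, ⟪P ξ, π b (P ξ)⟫_ℂ = ⟪P ξ, π b ξ⟫_ℂ := fun b => by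
    rw [← hcomm, ← hself, hPP]
  have hπ1 : π 1 ξ = ξ := by rw [gns_apply_gnsVector]; rfl
  set t : ℝ := ‖P ξ‖ ^ 2 with ht
  have htin : ⟪P ξ, ξ⟫_ℂ = t := by
    rw [← hPP, hself, inner_self_eq_norm_sq_to_K, ht]; norm_cast
  have hnorm : ‖ξ‖ = 1 := norm_gnsVector f hf.1.2.2.2
  have hξξ : ⟪ξ, ξ⟫_ℂ = 1 := by rw [inner_self_eq_norm_sq_to_K, hnorm]; simp
  have ht0 : 0 ≤ t := by positivity
  have ht1 : t ≤ 1 := by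
    have h : ‖P ξ‖ ≤ 1 := by
      rw [← hnorm]; exact Submodule.norm_starProjection_apply_le W ξ
    rw [ht]; exact pow_le_one₀ (norm_nonneg _) h
  have hvec : ∀ v : f.GNS, ∀ a : U, 0 ≤ a → 0 ≤ ⟪v, π a v⟫_ℂ := by
    intro v a ha
    obtain ⟨b, rfl⟩ := CStarAlgebra.nonneg_iff_eq_star_mul_self.1 ha
    rw [map_mul, map_star, ContinuousLinearMap.star_eq_adjoint, mul_apply_eq_comp,
      ContinuousLinearMap.adjoint_inner_right, inner_self_eq_norm_sq_to_K]
    exact_mod_cast (RCLike.ofReal_nonneg (K := ℂ)).2 (sq_nonneg ‖π b v‖)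
  set η := ξ - P ξ with hη
  have hηin : ∀ b, ⟪η, π b η⟫_ℂ = ⟪ξ, π b ξ⟫_ℂ - ⟪P ξ, π b ξ⟫_ℂ := fun b => by
    have h2 : ⟪ξ, π b (P ξ)⟫_ℂ = ⟪P ξ, π b ξ⟫_ℂ := by rw [← hcomm, hself]
    simp only [hη, map_sub, inner_sub_left, inner_sub_right, hinner, h2]
    ring
  have hval : ∀ b, f b = ⟪ξ, π b ξ⟫_ℂ := fun b => (inner_gns_gnsVector f b).symm
  rcases ht0.eq_or_lt with h0 | h0
  · left
    have hPξ : P ξ = 0 := by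
      have : ‖P ξ‖ = 0 := by rw [ht] at h0; exact pow_eq_zero_iff (two_ne_zero) |>.1 h0.symm
      exact norm_eq_zero.1 this
    have hP0 : P = 0 := hdense P 0 fun b => by rw [hcomm, hPξ]; simp
    rw [eq_bot_iff]
    intro v hv
    have : P v = v := Submodule.starProjection_eq_self_iff.2 hv
    rw [hP0] at this
    simpa using this.symm
  rcases ht1.eq_or_lt with h1 | h1
  · right
    have hη0 : η = 0 := by
      have := hηin 1
      rw [show π 1 η = η by rw [hη, map_sub, ← hcomm, hπ1], hπ1, hξξ, htin, h1,
        inner_self_eq_norm_sq_to_K] at this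
      simpa using this
    have hPξ : P ξ = ξ := (sub_eq_zero.1 hη0).symm
    have hP1 : P = 1 := hdense P 1 fun b => by rw [hcomm, hPξ]; simp
    rw [eq_top_iff]
    intro v _
    have : P v = v := by rw [hP1]; simp
    rw [← this]; exact Submodule.starProjection_apply_mem W v
  exfalso
  have hπ1' : ∀ v, π 1 v = v := by
    have : π 1 = 1 := hdense _ _ fun b => by
      rw [← mul_apply_eq_comp, ← map_mul]; simp
    intro v; rw [this]; simp
  have hmem : ∀ (v : f.GNS) (s : ℝ), 0 < s → ⟪v, v⟫_ℂ = s →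
      (fun b => (s : ℂ)⁻¹ * ⟪v, π b v⟫_ℂ) ∈ stateSet U := by
    intro v s hs hv
    have hsC : (s : ℂ) ≠ 0 := by exact_mod_cast hs.ne'
    refine ⟨fun a b => ?_, fun z a => ?_, fun a ha => ?_, ?_⟩
    · simp [inner_add_right, mul_add]
    · simp [inner_smul_right]; ring
    · exact mul_nonneg (inv_nonneg.2 (by exact_mod_cast hs.le)) (hvec v a ha)
    · simp only [hπ1', hv]; exact inv_mul_cancel₀ hsC
  have hm1 := hmem (P ξ) t h0 (by rw [hself, hPP, ← hself, htin])
  have hηη : ⟪η, η⟫_ℂ = ((1 - t : ℝ) : ℂ) := by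
    have := hηin 1
    rw [hπ1', hπ1, hξξ, htin] at this
    rw [this]; push_cast; rfl
  have hm2 := hmem η (1 - t) (by linarith) hηη
  have hseg : ⇑f ∈ openSegment ℝ (fun b => (t : ℂ)⁻¹ * ⟪P ξ, π b (P ξ)⟫_ℂ)
      (fun b => (((1 - t : ℝ)) : ℂ)⁻¹ * ⟪η, π b η⟫_ℂ) := by
    refine ⟨t, 1 - t, h0, by linarith, by ring, ?_⟩
    funext b
    have e1 : (t : ℂ) ≠ 0 := by exact_mod_cast h0.ne'
    have e2 : (((1 - t : ℝ)) : ℂ) ≠ 0 := by exact_mod_cast (sub_pos.2 h1).ne'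
    simp only [Pi.add_apply, Pi.smul_apply, Complex.real_smul]
    rw [mul_inv_cancel_left₀ e1, mul_inv_cancel_left₀ e2, hηin, hinner, hval]
    ring
  have heq := (mem_extremePoints.1 hf).2 _ hm1 _ hm2 hseg
  have heq1 : ∀ b, ⟪P ξ, π b ξ⟫_ℂ = t * ⟪ξ, π b ξ⟫_ℂ := fun b => by
    have e1 : (t : ℂ) ≠ 0 := by exact_mod_cast h0.ne'
    have := congrFun heq.1 b
    simp only [hinner, hval] at this
    rw [← this, mul_inv_cancel_left₀ e1]
  have hPt : P ξ = (t : ℂ) • ξ := by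
    have hz : ∀ w : f.GNS, ⟪P ξ - (t : ℂ) • ξ, w⟫_ℂ = 0 := by
      intro w
      induction w using UniformSpace.Completion.induction_on with
      | hp => exact isClosed_eq (by fun_prop) continuous_const
      | ih a =>
        have := heq1 (f.ofPreGNS a)
        rw [gns_apply_gnsVector] at this
        simp only [PositiveLinearMap.toPreGNS_ofPreGNS] at this
        rw [inner_sub_left, this, inner_smul_left]; simp
    exact sub_eq_zero.1 (inner_self_eq_zero.1 (hz _))
  have h3 : ((t : ℂ)) * t = t := by
    have h4 : ⟪P ξ, P ξ⟫_ℂ = t := by rw [hself, hPP, ← hself, htin]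
    rw [hPt, inner_smul_left, inner_smul_right, hξξ] at h4
    simpa using h4
  have h5 : t * t = t := by exact_mod_cast h3
  nlinarith

theorem gns_apply_ne_zero (f : U →ₚ[ℂ] ℂ) {b : U} (hb : f (star b * b) ≠ 0) :
    f.gnsNonUnitalStarAlgHom b ≠ 0 := by
  intro h
  apply hb
  rw [← inner_gns_gnsVector, map_mul, h, mul_zero]
  simp

/-- Irreducible representations separate the points of a `C*`-algebra. -/
theorem exists_irreducible_apply_ne_zero {B : Type u} [NonUnitalCStarAlgebra B] {b : B}
    (hb : b ≠ 0) : ∃ (H : Type u) (_ : NormedAddCommGroup H) (_ : InnerProductSpace ℂ H)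
      (_ : CompleteSpace H) (π : B →⋆ₙₐ[ℂ] (H →L[ℂ] H)), IsIrreducibleRep π ∧ π b ≠ 0 := by
  -- States are normalised at 1, so they are taken on the unitization; its unit acts as the
  -- identity, so `B`-invariant subspaces are invariant under all of it.
  let c : Unitization ℂ B := star (b : Unitization ℂ B) * b
  have hc : 0 ≤ c := star_mul_self_nonneg _
  have hc0 : c ≠ 0 := by
    rw [ne_eq, CStarRing.star_mul_self_eq_zero_iff]
    intro h
    exact hb (Unitization.inr_injective (h.trans (Unitization.inr_zero ℂ).symm))
  obtain ⟨φ, hφ, hφc⟩ := exists_extreme_state_apply_ne_zero hc hc0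
  let f := stateFunctional hφ.1
  have hf : ⇑f ∈ (stateSet (Unitization ℂ B)).extremePoints ℝ := hφ
  refine ⟨f.GNS, inferInstance, inferInstance, inferInstance,
    f.gnsNonUnitalStarAlgHom.comp (Unitization.inrNonUnitalStarAlgHom ℂ B), ?_,
    gns_apply_ne_zero f hφc⟩
  intro W hcl hW
  refine gns_invariant_of_extreme hf W hcl fun a v hv => ?_
  induction a using Unitization.ind with
  | inl_add_inr z a =>
    have h1 : f.gnsNonUnitalStarAlgHom 1 v = v := by
      change f.gnsStarAlgHom 1 v = v
      rw [map_one]; rfl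
    have h2 : (Unitization.inl z : Unitization ℂ B) = z • 1 := by
      rw [← Unitization.inl_one, ← Unitization.inl_smul, smul_eq_mul, mul_one]
    rw [map_add, h2, map_smul, add_apply, smul_apply, h1]
    exact W.add_mem (W.smul_mem z hv) (hW a v hv)

end States

/-! ### Matrix representations and simplicity of `M_n`. -/

section Matrices

variable {B : Type u} [NonUnitalCStarAlgebra B] {n : ℕ}

/-- In an `n`-homogeneous algebra the representations in `M_n` separate the points. -/
theorem IsHomogeneous.exists_matrix_rep (hB : IsHomogeneous n B) {b : B} (hb : b ≠ 0) :
    ∃ π : B →⋆ₙₐ[ℂ] Mat n, π b ≠ 0 := by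
  obtain ⟨H, _, _, _, π, hirr, hπb⟩ := exists_irreducible_apply_ne_zero hb
  have hrank := hB H π (fun h => hπb (by rw [h]; rfl)) hirr
  have hfin : FiniteDimensional ℂ H :=
    Module.rank_lt_aleph0_iff.1 (hrank ▸ Cardinal.natCast_lt_aleph0)
  have hfr : Module.finrank ℂ H = n := Module.finrank_eq_of_rank_eq hrank
  let e : H ≃ₗᵢ[ℂ] EuclideanSpace ℂ (Fin n) :=
    ((stdOrthonormalBasis ℂ H).reindex (finCongr hfr)).repr
  let F : (H →L[ℂ] H) ≃⋆ₐ[ℂ] Mat n :=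
    e.conjStarAlgEquiv.trans (Matrix.toEuclideanCLM (n := Fin n) (𝕜 := ℂ)).symm
  refine ⟨NonUnitalStarAlgHom.comp (F : (H →L[ℂ] H) →⋆ₙₐ[ℂ] Mat n) π, ?_⟩
  change F (π b) ≠ 0
  rwa [ne_eq, map_eq_zero_iff F F.injective]

/-- The algebra `M_n` is simple. -/
theorem eq_top_of_isIdeal (J : Submodule ℂ (Mat n)) (hJ : J ≠ ⊥)
    (hl : ∀ S, ∀ T ∈ J, S * T ∈ J) (hr : ∀ S, ∀ T ∈ J, T * S ∈ J) : J = ⊤ := by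
  obtain ⟨T, hT, hT0⟩ := J.ne_bot_iff.1 hJ
  have hex : ∃ i j, T i j ≠ 0 := by
    by_contra! h
    exact hT0 (Matrix.ext h)
  obtain ⟨i, j, hij⟩ := hex
  rw [eq_top_iff]
  intro S _
  rw [Matrix.matrix_eq_sum_single S]
  refine J.sum_mem fun p _ => J.sum_mem fun q _ => ?_
  have h : Matrix.single p q (S p q) =
      (S p q / T i j) • (Matrix.single p i 1 * T * Matrix.single j q 1) := by
    rw [Matrix.single_mul_mul_single]
    simp [hij]
  rw [h]
  exact J.smul_mem _ (hr _ _ (hl _ _ hT))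

end Matrices

/-! ### Irreducibility and surjectivity of nonzero representations in `M_n`. -/

section Irreducible

open scoped InnerProductSpace

variable {B : Type u} [NonUnitalCStarAlgebra B] {n : ℕ}

/-- The restriction of a representation to an invariant subspace. -/
def restrictRep {H : Type*} [NormedAddCommGroup H] [InnerProductSpace ℂ H] [CompleteSpace H]
    (π : B →⋆ₙₐ[ℂ] (H →L[ℂ] H)) (W : Submodule ℂ H) [CompleteSpace W]
    (hW : ∀ b : B, ∀ v ∈ W, π b v ∈ W) : B →⋆ₙₐ[ℂ] (W →L[ℂ] W) where
  toFun b := ((π b).comp W.subtypeL).codRestrict W fun v => hW b v v.2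
  map_smul' z b := by ext v; simp; rfl
  map_zero' := by ext v; simp
  map_add' a b := by ext v; simp; rfl
  map_mul' a b := by ext v; simp; rfl
  map_star' b := by
    rw [ContinuousLinearMap.star_eq_adjoint, ContinuousLinearMap.eq_adjoint_iff]
    intro v w
    change ⟪π (star b) v, (w : H)⟫_ℂ = ⟪(v : H), π b w⟫_ℂ
    rw [map_star, ContinuousLinearMap.star_eq_adjoint, ContinuousLinearMap.adjoint_inner_left]

/-- An invariant subspace of an `n`-dimensional representation of an `n`-homogeneous algebra
on which the algebra acts in a nonzero way is the whole space. -/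
theorem IsHomogeneous.eq_top_of_acts (hB : IsHomogeneous n B) {H : Type u} [NormedAddCommGroup H]
    [InnerProductSpace ℂ H] [FiniteDimensional ℂ H] [CompleteSpace H]
    (hH : Module.finrank ℂ H = n)
    (π : B →⋆ₙₐ[ℂ] (H →L[ℂ] H)) (W : Submodule ℂ H) (hW : ∀ b : B, ∀ v ∈ W, π b v ∈ W)
    (hact : ∃ b, ∃ v ∈ W, π b v ≠ 0) : W = ⊤ := by
  induction hd : Module.finrank ℂ W using Nat.strong_induction_on generalizing W with
  | _ d ih =>
  subst hd
  by_cases hirr : IsIrreducibleRep (restrictRep π W hW)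
  · have := hB W (restrictRep π W hW) (fun h => by
      obtain ⟨b, v, hv, hbv⟩ := hact
      exact hbv (congrArg Subtype.val
        (DFunLike.congr_fun (DFunLike.congr_fun h b) (⟨v, hv⟩ : W)))) hirr
    exact Submodule.eq_top_of_finrank_eq ((Module.finrank_eq_of_rank_eq this).trans hH.symm)
  -- Split `W` orthogonally into proper invariant subspaces `Y` and `Z`. By induction a piece with
  -- nonzero action would be all of `H`; so both are annihilated, and hence so is `W`.
  · exfalso
    simp only [IsIrreducibleRep, not_forall, not_or] at hirr
    obtain ⟨X, -, hX, hX0, hX1⟩ := hirr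
    let Y : Submodule ℂ H := X.map W.subtype
    have hYW : Y ≤ W := Submodule.map_subtype_le W X
    have hY : ∀ b : B, ∀ v ∈ Y, π b v ∈ Y := by
      rintro b _ ⟨v, hv, rfl⟩
      exact ⟨restrictRep π W hW b v, hX b v hv, rfl⟩
    have hY0 : Y ≠ ⊥ := by
      intro h
      apply hX0
      rw [eq_bot_iff]
      intro v hv
      have : (v : H) ∈ Y := ⟨v, hv, rfl⟩
      rw [h, Submodule.mem_bot] at this
      exact (Submodule.mem_bot ℂ).2 (Subtype.ext this)
    have hYlt : Y < W := by
      refine lt_of_le_of_ne hYW fun h => hX1 ?_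
      rw [eq_top_iff]
      intro v _
      have : (v : H) ∈ Y := h.ge v.2
      obtain ⟨w, hw, hwv⟩ := this
      rwa [← Subtype.ext (show (w : H) = v from hwv)]
    let Z : Submodule ℂ H := W ⊓ Yᗮ
    have hZ : ∀ b : B, ∀ v ∈ Z, π b v ∈ Z := fun b v hv =>
      ⟨hW b v hv.1, invariant_orthogonal π Y hY b v hv.2⟩
    have hZlt : Z < W := by
      refine lt_of_le_of_ne inf_le_left fun h => hY0 ?_
      rw [eq_bot_iff]
      intro v hv
      have : v ∈ Z := h.ge (hYW hv)
      exact (Submodule.mem_bot ℂ).2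
        (inner_self_eq_zero.1 ((Submodule.mem_orthogonal Y v).1 this.2 v hv))
    obtain ⟨b, v, hv, hbv⟩ := hact
    by_cases h1 : ∃ b, ∃ v ∈ Y, π b v ≠ 0
    · have := ih _ (Submodule.finrank_lt_finrank_of_lt hYlt) Y hY h1 rfl
      exact not_top_lt (this ▸ hYlt)
    by_cases h2 : ∃ b, ∃ v ∈ Z, π b v ≠ 0
    · have := ih _ (Submodule.finrank_lt_finrank_of_lt hZlt) Z hZ h2 rfl
      exact not_top_lt (this ▸ hZlt)
    push Not at h1 h2
    apply hbv
    have hp : Y.starProjection v ∈ Y := Submodule.starProjection_apply_mem Y v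
    have hz : v - Y.starProjection v ∈ Z :=
      ⟨W.sub_mem hv (hYW hp), Submodule.sub_starProjection_mem_orthogonal v⟩
    have := h2 b _ hz
    rwa [map_sub, h1 b _ hp, sub_zero] at this

/-- A nonzero `n`-dimensional representation of an `n`-homogeneous algebra is irreducible. -/
theorem IsHomogeneous.isIrreducibleRep (hB : IsHomogeneous n B) {H : Type u}
    [NormedAddCommGroup H] [InnerProductSpace ℂ H] [FiniteDimensional ℂ H] [CompleteSpace H]
    (hH : Module.finrank ℂ H = n) (π : B →⋆ₙₐ[ℂ] (H →L[ℂ] H)) (hπ : π ≠ 0) :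
    IsIrreducibleRep π := by
  -- The common kernel vanishes, since the algebra acts nontrivially on its orthogonal complement,
  -- which is therefore everything. Hence every nonzero invariant subspace is acted on nontrivially.
  let N : Submodule ℂ H := ⨅ b : B, LinearMap.ker (π b : H →ₗ[ℂ] H)
  have hN : ∀ v, v ∈ N ↔ ∀ b, π b v = 0 := fun v => by simp [N]
  have hNinv : ∀ b : B, ∀ v ∈ N, π b v ∈ N := fun b v hv => by
    rw [(hN v).1 hv b]; exact N.zero_mem
  have hbot : N = ⊥ := by
    rw [← Submodule.orthogonal_eq_top_iff]
    refine hB.eq_top_of_acts hH π Nᗮ (invariant_orthogonal π N hNinv) ?_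
    by_contra! h
    apply hπ
    ext b v
    have h1 := h b _ (Submodule.sub_starProjection_mem_orthogonal (K := N) v)
    rw [map_sub, (hN _).1 (Submodule.starProjection_apply_mem N v) b, sub_zero] at h1
    simpa using h1
  intro W _ hW
  refine or_iff_not_imp_left.2 fun hW0 => hB.eq_top_of_acts hH π W hW ?_
  obtain ⟨v, hv, hv0⟩ := W.ne_bot_iff.1 hW0
  by_contra! h
  exact hv0 ((Submodule.mem_bot ℂ).1 (hbot ▸ (hN v).2 fun b => h b v hv))

/-- Burnside's theorem for irreducible representations of `C*`-algebras: the image generates all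
operators. -/
theorem adjoin_range_eq_top_of_isIrreducibleRep {H : Type*} [NormedAddCommGroup H]
    [InnerProductSpace ℂ H] [FiniteDimensional ℂ H] [CompleteSpace H] [Nontrivial H]
    (π : B →⋆ₙₐ[ℂ] (H →L[ℂ] H)) (hirr : IsIrreducibleRep π) :
    Algebra.adjoin ℂ (Set.range π) = ⊤ := by
  set S := Algebra.adjoin ℂ (Set.range π) with hS
  have htower : IsScalarTower ℂ S H := ⟨fun _ _ _ => rfl⟩
  have hsimple : IsSimpleModule S H := by
    rw [isSimpleModule_iff]
    refine { exists_pair_ne := exists_pair_ne _, eq_bot_or_eq_top := fun W => ?_ }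
    let W' : Submodule ℂ H := W.restrictScalars ℂ
    rcases hirr W' W'.closed_of_finiteDimensional fun b v hv =>
        W.smul_mem (⟨π b, Algebra.subset_adjoin ⟨b, rfl⟩⟩ : S) hv with h | h
    · left
      exact (Submodule.restrictScalars_eq_bot_iff ℂ S H).1 h
    · right
      exact (Submodule.restrictScalars_eq_top_iff ℂ S H).1 h
  rw [eq_top_iff]
  intro T _
  -- By Schur's lemma over `ℂ` the commutant is scalar, so every `T` is linear over it; Jacobson
  -- density then matches `T` with an element of `S` on a basis.
  let f : Module.End (Module.End S H) H :=
    { toFun := T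
      map_add' := map_add T
      map_smul' := fun g v => by
        obtain ⟨z, rfl⟩ :=
          (IsSimpleModule.algebraMap_end_bijective_of_isAlgClosed (A := S) (V := H) ℂ).2 g
        simp }
  classical
  let s : Finset H := Finset.univ.image (Module.finBasis ℂ H)
  obtain ⟨r, hr⟩ := jacobson_density (R := S) f s
  have : T = (r : H →L[ℂ] H) := by
    apply ContinuousLinearMap.coe_injective
    refine (Module.finBasis ℂ H).ext fun i => ?_
    exact hr _ (Finset.mem_image_of_mem _ (Finset.mem_univ i))
  rw [this]
  exact r.2

/-- A nonzero representation of an `n`-homogeneous algebra in `M_n` is surjective. -/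
theorem IsHomogeneous.surjective (hn : 1 ≤ n) (hB : IsHomogeneous n B) (π : B →⋆ₙₐ[ℂ] Mat n)
    (hπ : π ≠ 0) : Function.Surjective π := by
  -- Homogeneity only tests Hilbert spaces in the universe of `B`, hence the lift.
  let H := EuclideanSpace ℂ (ULift.{u} (Fin n))
  let e : EuclideanSpace ℂ (Fin n) ≃ₗᵢ[ℂ] H :=
    LinearIsometryEquiv.piLpCongrLeft 2 ℂ ℂ Equiv.ulift.symm
  let F : Mat n ≃⋆ₐ[ℂ] (H →L[ℂ] H) :=
    (Matrix.toEuclideanCLM (n := Fin n) (𝕜 := ℂ)).trans e.conjStarAlgEquiv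
  let ρ : B →⋆ₙₐ[ℂ] (H →L[ℂ] H) := NonUnitalStarAlgHom.comp (F : Mat n →⋆ₙₐ[ℂ] (H →L[ℂ] H)) π
  have hρ : ∀ b, ρ b = F (π b) := fun b => rfl
  have hρ0 : ρ ≠ 0 := by
    intro h
    apply hπ
    ext1 b
    have : F (π b) = 0 := DFunLike.congr_fun h b
    exact (map_eq_zero_iff F F.injective).1 this
  have hH : Module.finrank ℂ H = n := by simp [H]
  have : Nontrivial H := Module.nontrivial_of_finrank_pos (R := ℂ) (by rw [hH]; exact hn)
  have htop := adjoin_range_eq_top_of_isIrreducibleRep ρ (hB.isIrreducibleRep hH ρ hρ0)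
  -- Burnside concerns the unital algebra generated by the image, whereas `B` may have no unit. The
  -- image is a two-sided ideal of that algebra, and simplicity of `M_n` finishes.
  have hideal : ∀ T : H →L[ℂ] H, ∀ b, (∃ c, T * ρ b = ρ c) ∧ ∃ c, ρ b * T = ρ c := by
    intro T
    have hT : T ∈ Algebra.adjoin ℂ (Set.range ρ) := htop ▸ Algebra.mem_top
    induction hT using Algebra.adjoin_induction with
    | mem T hT =>
      obtain ⟨a, rfl⟩ := hT
      exact fun b => ⟨⟨a * b, (map_mul ρ a b).symm⟩, ⟨b * a, (map_mul ρ b a).symm⟩⟩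
    | algebraMap z =>
      intro b
      exact ⟨⟨z • b, by simp [Algebra.algebraMap_eq_smul_one]⟩,
        ⟨z • b, by simp [Algebra.algebraMap_eq_smul_one]⟩⟩
    | add S T _ _ hS hT =>
      intro b
      obtain ⟨⟨c, hc⟩, d, hd⟩ := hS b
      obtain ⟨⟨c', hc'⟩, d', hd'⟩ := hT b
      exact ⟨⟨c + c', by rw [add_mul, hc, hc', map_add]⟩,
        ⟨d + d', by rw [mul_add, hd, hd', map_add]⟩⟩
    | mul S T _ _ hS hT =>
      intro b
      obtain ⟨c, hc⟩ := (hT b).1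
      obtain ⟨c', hc'⟩ := (hS c).1
      obtain ⟨d, hd⟩ := (hS b).2
      obtain ⟨d', hd'⟩ := (hT d).2
      exact ⟨⟨c', by rw [mul_assoc, hc, hc']⟩, ⟨d', by rw [← mul_assoc, hd, hd']⟩⟩
  have hJ := eq_top_of_isIdeal (LinearMap.range (π : B →ₗ[ℂ] Mat n))
    (by
      intro h
      apply hπ
      ext1 b
      exact (Submodule.mem_bot ℂ).1 (h ▸ LinearMap.mem_range_self (π : B →ₗ[ℂ] Mat n) b))
    (by
      rintro S _ ⟨b, rfl⟩
      obtain ⟨c, hc⟩ := (hideal (F S) b).1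
      refine ⟨c, F.injective ?_⟩
      rw [map_mul]
      exact hc.symm)
    (by
      rintro S _ ⟨b, rfl⟩
      obtain ⟨c, hc⟩ := (hideal (F S) b).2
      refine ⟨c, F.injective ?_⟩
      rw [map_mul]
      exact hc.symm)
  exact LinearMap.range_eq_top.1 hJ

end Irreducible

/-! ### Conjugate or separated: comparing two representations. -/

section Equivalence

/-- Every `*`-automorphism of `M_n` is the conjugation by a unitary matrix. -/
theorem exists_smul_eq_of_starAlgEquiv {n : ℕ} (f : Mat n ≃⋆ₐ[ℂ] Mat n) :
    ∃ u : PU n, ∀ T, f T = u • T := by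
  let E := Matrix.toEuclideanCLM (n := Fin n) (𝕜 := ℂ)
  let g := E.symm.trans (f.trans E)
  have hg : Continuous g := LinearMap.continuous_of_finiteDimensional
    ({ toFun := g, map_add' := map_add g, map_smul' := map_smul g } :
      (EuclideanSpace ℂ (Fin n) →L[ℂ] EuclideanSpace ℂ (Fin n)) →ₗ[ℂ]
        (EuclideanSpace ℂ (Fin n) →L[ℂ] EuclideanSpace ℂ (Fin n)))
  obtain ⟨V, hV⟩ := g.eq_linearIsometryEquivConjStarAlgEquiv hg
  let W := Unitary.linearIsometryEquiv.symm V
  refine ⟨PU.mk ⟨E.symm W, Unitary.map_mem E.symm W.2⟩, fun T => ?_⟩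
  rw [PU.mk_smul]
  apply E.injective
  have h1 : E (f T) = V.conjStarAlgEquiv (E T) := by
    rw [← hV]; simp [g]
  have h2 : ∀ Y, E (E.symm Y) = Y := E.apply_symm_apply
  change E (f T) = E (E.symm W * T * star (E.symm W))
  rw [h1, map_mul, map_mul, map_star, h2,
    ← Unitary.conjStarAlgAut_symm_unitaryLinearIsometryEquiv]
  rfl

/-- The image under `π` of the kernel of `ρ` is an ideal of the simple algebra `M_n`. If it is zero,
`π` factors through `ρ` by an automorphism, which is inner; if it is everything, it contains 1. -/
theorem exists_smul_eq_or_exists_separating {B : Type u} [NonUnitalCStarAlgebra B] {n : ℕ}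
    (π ρ : B →⋆ₙₐ[ℂ] Mat n) (hπ : Function.Surjective π) (hρ : Function.Surjective ρ) :
    (∃ u : PU n, ∀ b, ρ b = u • π b) ∨ ∃ e, π e = 1 ∧ ρ e = 0 := by
  let J : Submodule ℂ (Mat n) :=
    (LinearMap.ker (ρ : B →ₗ[ℂ] Mat n)).map (π : B →ₗ[ℂ] Mat n)
  have hJ : ∀ T, T ∈ J ↔ ∃ b, ρ b = 0 ∧ π b = T := fun T => by
    simp only [J, Submodule.mem_map, LinearMap.mem_ker]; rfl
  by_cases h : J = ⊥
  · left
    have hker : ∀ b c, ρ b = ρ c → π b = π c := fun b c hbc => by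
      have : π (b - c) ∈ J := (hJ _).2 ⟨b - c, by rw [map_sub, hbc, sub_self], rfl⟩
      rw [h, Submodule.mem_bot, map_sub] at this
      exact sub_eq_zero.1 this
    choose s hs using hρ
    have hθ : ∀ b, π (s (ρ b)) = π b := fun b => hker _ _ (hs _)
    let θ : Mat n →⋆ₙₐ[ℂ] Mat n :=
      { toFun := fun T => π (s T)
        map_smul' := fun z T => by
          change _ = z • π (s T)
          rw [← map_smul]; exact hker _ _ (by rw [map_smul, hs, hs])
        map_zero' := (hker _ 0 (by rw [hs, map_zero])).trans (map_zero π)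
        map_add' := fun S T => by
          rw [← map_add]; exact hker _ _ (by rw [map_add, hs, hs, hs])
        map_mul' := fun S T => by
          rw [← map_mul]; exact hker _ _ (by rw [map_mul, hs, hs, hs])
        map_star' := fun T => by
          rw [← map_star]; exact hker _ _ (by rw [map_star, hs, hs]) }
    have hsurj : Function.Surjective θ := fun T => by
      obtain ⟨b, rfl⟩ := hπ T
      exact ⟨ρ b, hθ b⟩
    have hinj : Function.Injective θ :=
      (LinearMap.injective_iff_surjective (f := (θ : Mat n →ₗ[ℂ] Mat n))).2 hsurj
    let f : Mat n ≃⋆ₐ[ℂ] Mat n := StarAlgEquiv.ofBijective θ ⟨hinj, hsurj⟩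
    obtain ⟨u, hu⟩ := exists_smul_eq_of_starAlgEquiv f.symm
    refine ⟨u, fun b => ?_⟩
    rw [← hu]
    have h1 : f (ρ b) = f (f.symm (π b)) := (hθ b).trans (f.apply_symm_apply _).symm
    exact f.injective h1
  · right
    have htop := eq_top_of_isIdeal J h
      (fun S T hT => by
        obtain ⟨b, hb, rfl⟩ := (hJ _).1 hT
        obtain ⟨c, rfl⟩ := hπ S
        exact (hJ _).2 ⟨c * b, by rw [map_mul, hb, mul_zero], map_mul _ _ _⟩)
      (fun S T hT => by
        obtain ⟨b, hb, rfl⟩ := (hJ _).1 hT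
        obtain ⟨c, rfl⟩ := hπ S
        exact (hJ _).2 ⟨b * c, by rw [map_mul, hb, zero_mul], map_mul _ _ _⟩)
    obtain ⟨e, he0, he1⟩ := (hJ 1).1 (htop ▸ Submodule.mem_top)
    exact ⟨e, he1, he0⟩

end Equivalence

/-! ### Matrix-valued partitions of unity and Stone–Weierstrass. -/

section Approximation

open Filter Topology

open scoped MatrixOrder ComplexOrder

variable {n : ℕ}

/-- The norm is one of the eigenvalues, and the others are nonnegative. -/
theorem norm_le_trace_of_nonneg {P : Mat n} (hP : 0 ≤ P) : ‖P‖ ≤ P.trace.re := by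
  rcases isEmpty_or_nonempty (Fin n) with h | h
  · rw [Subsingleton.elim P 0]; simp
  have hps := Matrix.nonneg_iff_posSemidef.1 hP
  have hmem : ‖P‖ ∈ spectrum ℝ P := CStarAlgebra.norm_mem_spectrum_of_nonneg hP
  rw [hps.1.spectrum_real_eq_range_eigenvalues] at hmem
  obtain ⟨i, hi⟩ := hmem
  rw [hps.1.trace_eq_sum_eigenvalues, ← hi]
  simp only [Complex.re_sum, Complex.coe_algebraMap, Complex.ofReal_re]
  simpa using Finset.single_le_sum (f := hps.1.eigenvalues)
    (fun j _ => hps.eigenvalues_nonneg j) (Finset.mem_univ i)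

/-- The trace is additive, so the bound does not depend on the number of summands. This controls the
gluing error whatever the size of the cover. -/
theorem sum_norm_le_of_sum_le_one {ι : Type*} (t : Finset ι) (P : ι → Mat n)
    (hP : ∀ i ∈ t, 0 ≤ P i) (hsum : ∑ i ∈ t, P i ≤ 1) : ∑ i ∈ t, ‖P i‖ ≤ n := by
  calc ∑ i ∈ t, ‖P i‖ ≤ ∑ i ∈ t, (P i).trace.re :=
        Finset.sum_le_sum fun i hi => norm_le_trace_of_nonneg (hP i hi)
    _ = (∑ i ∈ t, P i).trace.re := by rw [Matrix.trace_sum, Complex.re_sum]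
    _ ≤ (1 : Mat n).trace.re := by
        have h := (Matrix.le_iff.1 hsum).trace_nonneg
        rw [Matrix.trace_sub, sub_nonneg] at h
        exact (Complex.le_def.1 h).1
    _ = n := by simp

/-- A square root of a cut-off function, divided by the identity function. -/
def cutoff (t : ℝ) : ℝ := √t / max t (1 / 2)

theorem continuous_cutoff : Continuous cutoff :=
  Real.continuous_sqrt.div (continuous_id.max continuous_const) fun t =>
    (lt_of_lt_of_le (by norm_num) (le_max_right t (1 / 2))).ne'

theorem cutoff_mul_mul {t : ℝ} (ht : 0 ≤ t) :
    cutoff t * t * cutoff t = (t / max t (1 / 2)) ^ 2 := by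
  have h := Real.mul_self_sqrt ht
  unfold cutoff
  calc √t / max t (1 / 2) * t * (√t / max t (1 / 2))
      = (√t * √t) * t / (max t (1 / 2)) ^ 2 := by ring
    _ = _ := by rw [h]; ring

/-- The product is the functional calculus of `(t / max t (1/2)) ^ 2`, which lies in `[0, 1]` for `t
≥ 0` and equals 1 for `t ≥ 1/2`. As `cutoff 0 = 0`, the same normalisation is available in a
nonunital algebra. -/
theorem cutoff_conj_le_one {S : Mat n} (hS : 0 ≤ S) :
    0 ≤ cfcₙ cutoff S * S * cfcₙ cutoff S ∧ cfcₙ cutoff S * S * cfcₙ cutoff S ≤ 1 ∧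
      (algebraMap ℝ (Mat n) (1 / 2) ≤ S → cfcₙ cutoff S * S * cfcₙ cutoff S = 1) := by
  have hsa : IsSelfAdjoint S := .of_nonneg hS
  have hc := continuous_cutoff
  have h1 : cfcₙ cutoff S * S * cfcₙ cutoff S = cfc (fun t => cutoff t * t * cutoff t) S := by
    rw [cfcₙ_eq_cfc (hf := hc.continuousOn) (hf0 := by simp [cutoff])]
    rw [cfc_mul (fun t => cutoff t * t) cutoff S (by fun_prop) (by fun_prop),
      cfc_mul cutoff (fun t => t) S (by fun_prop) (by fun_prop), cfc_id' ℝ S]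
  have hnn : ∀ t ∈ spectrum ℝ S, 0 ≤ t := fun t ht => spectrum_nonneg_of_nonneg hS ht
  rw [h1]
  refine ⟨cfc_nonneg fun t ht => ?_, cfc_le_one _ _ fun t ht => ?_, fun h => ?_⟩
  · rw [cutoff_mul_mul (hnn t ht)]; positivity
  · rw [cutoff_mul_mul (hnn t ht)]
    have hm : 0 < max t (1 / 2) := lt_of_lt_of_le (by norm_num) (le_max_right t (1 / 2))
    refine pow_le_one₀ (div_nonneg (hnn t ht) hm.le) ?_
    rw [div_le_one hm]; exact le_max_left _ _
  · have h2 : (spectrum ℝ S).EqOn (fun t => cutoff t * t * cutoff t) (fun _ => 1) := fun t ht => by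
      have h3 : 1 / 2 ≤ t := (algebraMap_le_iff_le_spectrum hsa).1 h t ht
      change cutoff t * t * cutoff t = 1
      rw [cutoff_mul_mul (hnn t ht), max_eq_left h3, div_self (by linarith), one_pow]
    rw [cfc_congr h2, cfc_const_one ℝ S]

variable {B : Type u} [NonUnitalCStarAlgebra B] {X : Type*} [TopologicalSpace X]

theorem map_cfcₙ_rep (π : B →⋆ₙₐ[ℂ] Mat n) {g : ℝ → ℝ} (hg : Continuous g) (hg0 : g 0 = 0)
    {p : B} (hp : IsSelfAdjoint p) : π (cfcₙ g p) = cfcₙ g (π p) := by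
  have hπ : Continuous π :=
    AddMonoidHomClass.continuous_of_bound π 1 (by simpa using NonUnitalStarAlgHom.norm_apply_le π)
  exact NonUnitalStarAlgHomClass.map_cfcₙ (S := ℂ) π g p hg.continuousOn hg0 hπ hp (hp.map π)

/-- The function used for making an element vanish near a point. -/
def ramp (t : ℝ) : ℝ := max 0 (2 * t - 1)

theorem continuous_ramp : Continuous ramp := by unfold ramp; fun_prop

theorem rep_ramp_eq_one (π : B →⋆ₙₐ[ℂ] Mat n) {p : B} (hp : IsSelfAdjoint p) (h : π p = 1) :
    π (cfcₙ ramp p) = 1 := by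
  rw [map_cfcₙ_rep π continuous_ramp (by norm_num [ramp]) hp, h,
    cfcₙ_eq_cfc (hf := continuous_ramp.continuousOn) (hf0 := by norm_num [ramp]), cfc_apply_one]
  norm_num [ramp]

theorem rep_ramp_eq_zero (π : B →⋆ₙₐ[ℂ] Mat n) {p : B} (hp : IsSelfAdjoint p)
    (h : ‖π p‖ < 1 / 2) : π (cfcₙ ramp p) = 0 := by
  rw [map_cfcₙ_rep π continuous_ramp (by norm_num [ramp]) hp,
    cfcₙ_eq_cfc (hf := continuous_ramp.continuousOn) (hf0 := by norm_num [ramp])]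
  have h2 : (spectrum ℝ (π p)).EqOn ramp (fun _ => 0) := fun t ht => by
    have h3 : ‖t‖ ≤ ‖π p‖ * ‖(1 : Mat n)‖ := spectrum.norm_le_norm_mul_of_mem ht
    have h1 : ‖(1 : Mat n)‖ ≤ 1 := by
      rcases isEmpty_or_nonempty (Fin n) with h | h
      · rw [Subsingleton.elim (1 : Mat n) 0]; simp
      · simp
    have h4 : t ≤ 1 / 2 := by
      have := le_abs_self t
      rw [Real.norm_eq_abs] at h3
      nlinarith [norm_nonneg (π p)]
    exact max_eq_left (by linarith)
  rw [cfc_congr h2, cfc_const_zero ℝ]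

/-- An element separating a point from each point of a closed set can be chosen to vanish on
that set. -/
theorem exists_rep_eq_one_vanishing {r : X → B →⋆ₙₐ[ℂ] Mat n}
    (hr : ∀ b, Continuous fun c => r c b)
    (hr0 : ∀ b, Tendsto (fun c => r c b) (cocompact X) (𝓝 0)) {a : X} (ha : ∃ e, r a e = 1)
    {F : Set X} (hF : IsClosed F) (hsep : ∀ c ∈ F, ∃ e, r a e = 1 ∧ r c e = 0) :
    ∃ e, r a e = 1 ∧ ∀ c ∈ F, r c e = 0 := by
  have hsq : ∀ e : B, r a e = 1 → r a (star e * e) = 1 := fun e he => by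
    rw [map_mul, map_star, he]; simp
  obtain ⟨e₀, he₀⟩ := ha
  let p := star e₀ * e₀
  have hp : IsSelfAdjoint p := .star_mul_self _
  obtain ⟨K, hK, hKp⟩ : ∃ K : Set X, IsCompact K ∧ ∀ c ∉ K, ‖r c p‖ < 1 / 2 := by
    have := (hr0 p).norm.eventually_lt_const (show ‖(0 : Mat n)‖ < 1 / 2 by norm_num)
    obtain ⟨K, hK, hKs⟩ := mem_cocompact.1 this
    exact ⟨K, hK, fun c hc => hKs hc⟩
  obtain ⟨e₁, he₁, he₁F⟩ : ∃ e, r a e = 1 ∧ ∀ c ∈ K ∩ F, r c e = 0 := by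
    refine (hK.inter_right hF).induction_on (p := fun s => ∃ e, r a e = 1 ∧ ∀ c ∈ s, r c e = 0)
      ⟨e₀, he₀, by simp⟩ ?_ ?_ ?_
    · rintro s t hst ⟨e, he, het⟩
      exact ⟨e, he, fun c hc => het c (hst hc)⟩
    · rintro s t ⟨e, he, hes⟩ ⟨e', he', het⟩
      refine ⟨e * e', by rw [map_mul, he, he', one_mul], ?_⟩
      rintro c (hc | hc)
      · rw [map_mul, hes c hc, zero_mul]
      · rw [map_mul, het c hc, mul_zero]
    -- Near `c` the positive element has norm below 1/2; `ramp` makes it exactly zero there while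
    -- keeping the value 1 at `a`.
    · rintro c ⟨-, hc⟩
      obtain ⟨e, he, hec⟩ := hsep c hc
      have hq : IsSelfAdjoint (star e * e) := .star_mul_self _
      have hN : {c' | ‖r c' (star e * e)‖ < 1 / 2} ∈ 𝓝 c := by
        refine (isOpen_lt (hr _).norm continuous_const).mem_nhds ?_
        simp [hec]
      exact ⟨_, mem_nhdsWithin_of_mem_nhds hN, cfcₙ ramp (star e * e),
        rep_ramp_eq_one _ hq (hsq e he), fun c' hc' => rep_ramp_eq_zero _ hq hc'⟩
  -- The first factor vanishes off `K`, the second on `K ∩ F`.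
  refine ⟨cfcₙ ramp p * e₁, ?_, fun c hc => ?_⟩
  · rw [map_mul, rep_ramp_eq_one _ hp (hsq e₀ he₀), he₁, one_mul]
  · by_cases hcK : c ∈ K
    · rw [map_mul, he₁F c ⟨hcK, hc⟩, mul_zero]
    · rw [map_mul, rep_ramp_eq_zero _ hp (hKp c hcK), zero_mul]

/-- A Stone–Weierstrass theorem for matrix-valued functions. -/
theorem exists_uniform_approx {r : X → B →⋆ₙₐ[ℂ] Mat n} (hr : ∀ b, Continuous fun c => r c b)
    (hr0 : ∀ b, Tendsto (fun c => r c b) (cocompact X) (𝓝 0)) {f : X → Mat n} (hf : Continuous f)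
    (hf0 : Tendsto f (cocompact X) (𝓝 0))
    (h : ∀ a, (∃ e, r a e = 1) ∧
      ∃ b, r a b = f a ∧ ∀ c, r c b = f c ∨ ∃ e, r a e = 1 ∧ r c e = 0)
    {ε : ℝ} (hε : 0 < ε) : ∃ b, ∀ c, ‖f c - r c b‖ ≤ ε + n * ε := by
  choose h1 b hb hsep using h
  -- `d a` is a bump at `a`, supported where the interpolant `b a` is within `ε` of `f`.
  have hd : ∀ a, ∃ d, r a d = 1 ∧ ∀ c, ε ≤ ‖f c - r c (b a)‖ → r c d = 0 := fun a => by
    refine exists_rep_eq_one_vanishing hr hr0 (h1 a)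
      (F := {c | ε ≤ ‖f c - r c (b a)‖}) (isClosed_le continuous_const (hf.sub (hr _)).norm) ?_
    intro c hc
    refine (hsep a c).resolve_left fun hca => ?_
    rw [Set.mem_ofPred_eq, hca, sub_self, norm_zero] at hc
    exact hε.not_ge hc
  choose d hd1 hd0 using hd
  obtain ⟨K, hK, hKf⟩ : ∃ K : Set X, IsCompact K ∧ ∀ c ∉ K, ‖f c‖ < ε := by
    have := hf0.norm.eventually_lt_const (show ‖(0 : Mat n)‖ < ε by simpa using hε)
    obtain ⟨K, hK, hKs⟩ := mem_cocompact.1 this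
    exact ⟨K, hK, fun c hc => hKs hc⟩
  let W : X → Set X := fun a => {c | ‖1 - r c (star (d a) * d a)‖ < 1 / 2}
  have hW : ∀ a ∈ K, W a ∈ 𝓝 a := fun a _ => by
    refine (isOpen_lt (continuous_const.sub (hr _)).norm continuous_const).mem_nhds ?_
    simp [map_mul, map_star, hd1]
  obtain ⟨t, -, ht⟩ := hK.elim_nhds_subcover W hW
  let s : B := ∑ a ∈ t, star (d a) * d a
  have hs : IsSelfAdjoint s := by
    simp only [s, IsSelfAdjoint, star_sum, star_mul, star_star]
  let k : B := cfcₙ cutoff s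
  have hk : IsSelfAdjoint k := cfcₙ_predicate _ _
  -- The weights sum to `k * s * k`: conjugating by `k` keeps each weight positive, bounds the sum
  -- by 1, and makes it 1 on `K`, where `s` is at least 1/2.
  refine ⟨∑ a ∈ t, star (d a * k) * (d a * k) * b a, fun c => ?_⟩
  let P : X → Mat n := fun a => r c (star (d a * k) * (d a * k))
  have hP : ∀ a, 0 ≤ P a := fun a => by
    simp only [P, map_mul (r c) (star (d a * k)), map_star]
    exact star_mul_self_nonneg _
  have hS : 0 ≤ r c s := by
    simp only [s, map_sum, map_mul, map_star]
    exact Finset.sum_nonneg fun a _ => star_mul_self_nonneg _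
  have hQ : ∑ a ∈ t, P a = cfcₙ cutoff (r c s) * r c s * cfcₙ cutoff (r c s) := by
    rw [← map_cfcₙ_rep _ continuous_cutoff (by simp [cutoff]) hs]
    simp only [P, ← map_sum, ← map_mul]
    congr 1
    change _ = k * s * k
    simp only [s, Finset.mul_sum, Finset.sum_mul, star_mul, hk.star_eq, mul_assoc]
  obtain ⟨hQ0, hQ1, hQK⟩ := cutoff_conj_le_one hS
  rw [← hQ] at hQ0 hQ1 hQK
  set Q := ∑ a ∈ t, P a
  have hfirst : ‖(1 - Q) * f c‖ ≤ ε := by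
    by_cases hc : c ∈ K
    · rw [hQK, sub_self, zero_mul, norm_zero]
      · exact hε.le
      obtain ⟨a, hat, hca⟩ := Set.mem_iUnion₂.1 (ht hc)
      have h3 : r c (star (d a) * d a) ≤ r c s := by
        simp only [s, map_sum]
        refine Finset.single_le_sum (f := fun a => r c (star (d a) * d a)) (fun i _ => ?_) hat
        simp only [map_mul, map_star]
        exact star_mul_self_nonneg _
      refine le_trans ?_ h3
      have hsa : IsSelfAdjoint (1 - r c (star (d a) * d a)) :=
        (IsSelfAdjoint.one _).sub ((IsSelfAdjoint.star_mul_self (d a)).map (r c))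
      have h4 := hsa.le_algebraMap_norm_self
      have h5 : algebraMap ℝ (Mat n) ‖1 - r c (star (d a) * d a)‖ ≤ algebraMap ℝ (Mat n) (1 / 2) :=
        algebraMap_mono _ (le_of_lt hca)
      have h6 := h4.trans h5
      have h7 : algebraMap ℝ (Mat n) (1 / 2) + algebraMap ℝ (Mat n) (1 / 2) = 1 := by
        rw [← map_add]; norm_num
      rw [sub_le_iff_le_add, ← h7] at h6
      exact le_of_add_le_add_left h6
    · have h3 : ‖1 - Q‖ ≤ 1 := by
        rw [CStarAlgebra.norm_le_one_iff_of_nonneg _ (sub_nonneg.2 hQ1)]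
        exact sub_le_self _ hQ0
      calc ‖(1 - Q) * f c‖ ≤ ‖1 - Q‖ * ‖f c‖ := norm_mul_le _ _
        _ ≤ 1 * ε := mul_le_mul h3 (hKf c hc).le (norm_nonneg _) zero_le_one
        _ = ε := one_mul _
  have hsecond : ∀ a, ‖P a * (f c - r c (b a))‖ ≤ ‖P a‖ * ε := fun a => by
    by_cases hc : ε ≤ ‖f c - r c (b a)‖
    · have : P a = 0 := by
        simp only [P, map_mul, hd0 a c hc, zero_mul, mul_zero]
      simp [this]
    · exact (norm_mul_le _ _).trans
        (mul_le_mul_of_nonneg_left (not_le.1 hc).le (norm_nonneg _))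
  -- The first term is small since `Q = 1` on `K` and `f` is small off `K`; in the second, each
  -- weight vanishes wherever its interpolant is bad.
  have hsplit : f c - r c (∑ a ∈ t, star (d a * k) * (d a * k) * b a) =
      (1 - Q) * f c + ∑ a ∈ t, P a * (f c - r c (b a)) := by
    have h3 : r c (∑ a ∈ t, star (d a * k) * (d a * k) * b a) = ∑ a ∈ t, P a * r c (b a) := by
      rw [map_sum]
      exact Finset.sum_congr rfl fun a _ => map_mul _ _ _
    simp only [h3, mul_sub, Finset.sum_sub_distrib, ← Finset.sum_mul, Q]
    rw [sub_mul, one_mul]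
    abel
  rw [hsplit]
  calc _ ≤ ‖(1 - Q) * f c‖ + ‖∑ a ∈ t, P a * (f c - r c (b a))‖ := norm_add_le _ _
    _ ≤ ε + ∑ a ∈ t, ‖P a‖ * ε :=
        add_le_add hfirst ((norm_sum_le _ _).trans (Finset.sum_le_sum fun a _ => hsecond a))
    _ ≤ ε + n * ε := by
        rw [← Finset.sum_mul]
        gcongr
        exact sum_norm_le_of_sum_le_one t P (fun a _ => hP a) hQ1

end Approximation

/-! ### The Gelfand transform. -/

section Gelfand

open Filter Topology

variable {A : Type u} [NonUnitalCStarAlgebra A] {n k : ℕ} {x : Fin k → A}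

/-- A closed property which is stable under the algebraic operations holds on the whole of the
generated `C*`-algebra if it holds for the generators. -/
theorem generated_induction {p : generated x → Prop} (hcl : IsClosed {b | p b})
    (hgen : ∀ j, p (gen x j)) (hzero : p 0) (hadd : ∀ a b, p a → p b → p (a + b))
    (hmul : ∀ a b, p a → p b → p (a * b)) (hsmul : ∀ (z : ℂ) a, p a → p (z • a))
    (hstar : ∀ a, p a → p (star a)) (b : generated x) : p b := by
  have hle : NonUnitalStarAlgebra.adjoin ℂ (Set.range x) ≤ generated x :=
    NonUnitalStarSubalgebra.le_topologicalClosure _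
  have hadj : ∀ y (hy : y ∈ NonUnitalStarAlgebra.adjoin ℂ (Set.range x)), p ⟨y, hle hy⟩ := by
    intro y hy
    induction hy using NonUnitalStarAlgebra.adjoin_induction with
    | mem y hy => obtain ⟨j, rfl⟩ := hy; exact hgen j
    | add a b _ _ ha hb => exact hadd _ _ ha hb
    | zero => exact hzero
    | mul a b _ _ ha hb => exact hmul _ _ ha hb
    | smul z a _ ha => exact hsmul z _ ha
    | star a _ ha => exact hstar _ ha
  have hclosed : IsClosed (Subtype.val '' {b : generated x | p b} : Set A) :=
    (NonUnitalStarSubalgebra.isClosed_topologicalClosure _).isClosedEmbedding_subtypeVal.isClosedMap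
      _ hcl
  have hsub : (generated x : Set A) ⊆ Subtype.val '' {b : generated x | p b} :=
    closure_minimal (fun y hy => ⟨⟨y, hle hy⟩, hadj y hy, rfl⟩) hclosed
  obtain ⟨c, hc, hcb⟩ := hsub b.2
  rwa [← Subtype.ext hcb]

theorem starAlgHom_generated_ext {C : Type*} [NonUnitalCStarAlgebra C]
    {π ρ : generated x →⋆ₙₐ[ℂ] C} (h : ∀ j, π (gen x j) = ρ (gen x j)) : π = ρ := by
  have hcont : ∀ π : generated x →⋆ₙₐ[ℂ] C, Continuous π := fun π =>
    AddMonoidHomClass.continuous_of_bound π 1 (by simpa using NonUnitalStarAlgHom.norm_apply_le π)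
  ext1 b
  refine generated_induction (p := fun b => π b = ρ b) (isClosed_eq (hcont π) (hcont ρ)) h
    (by rw [map_zero, map_zero]) (fun a b ha hb => by rw [map_add, map_add, ha, hb])
    (fun a b ha hb => by rw [map_mul, map_mul, ha, hb])
    (fun z a ha => by rw [map_smul, map_smul, ha])
    (fun a ha => by rw [map_star, map_star, ha]) b

/-- The representation of the generated `C*`-algebra given by a point of the `n`-spectrum. -/
def repAt (a : nSpectrum n x) : generated x →⋆ₙₐ[ℂ] Mat n := a.2.choose

theorem repAt_ne_zero (a : nSpectrum n x) : repAt a ≠ 0 := a.2.choose_spec.1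

theorem repAt_gen (a : nSpectrum n x) (j : Fin k) : repAt a (gen x j) = (a : Fin k → Mat n) j :=
  (congrFun a.2.choose_spec.2 j).symm

theorem repAt_smul (u : PU n) (a : nSpectrum n x) (b : generated x) :
    repAt (u • a) b = u • repAt a b := by
  have h : repAt (u • a) = NonUnitalStarAlgHom.comp
      ((PU.conj n u : Mat n ≃⋆ₐ[ℂ] Mat n) : Mat n →⋆ₙₐ[ℂ] Mat n) (repAt a) := by
    refine starAlgHom_generated_ext fun j => ?_
    change _ = PU.conj n u (repAt a (gen x j))
    rw [repAt_gen, repAt_gen, coe_smul_nSpectrum, PU.smul_def]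
  rw [h]; rfl

/-- Generators give the coordinate projections. The property survives limits because evaluations are
contractive, so convergence in the algebra makes the functions uniformly Cauchy. -/
theorem exists_zeroAtInfty_eq_repAt (b : generated x) :
    ∃ f : ZeroAtInftyContinuousMap (nSpectrum n x) (Mat n), ∀ a, f a = repAt a b := by
  refine generated_induction
    (p := fun b => ∃ f : ZeroAtInftyContinuousMap (nSpectrum n x) (Mat n), ∀ a, f a = repAt a b)
    ?_ ?_ ⟨0, fun a => by simp⟩ ?_ ?_ ?_ ?_ b
  · refine IsSeqClosed.isClosed ?_
    intro s b hs hsb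
    choose f hf using hs
    have hdist : ∀ l m, dist (f l) (f m) ≤ dist (s l) (s m) := by
      intro l m
      rw [← ZeroAtInftyContinuousMap.isometry_toBCF.dist_eq,
        BoundedContinuousFunction.dist_le dist_nonneg]
      intro a
      change dist (f l a) (f m a) ≤ _
      rw [hf, hf, dist_eq_norm, dist_eq_norm, ← map_sub]
      exact NonUnitalStarAlgHom.norm_apply_le (repAt a) _
    have hcau : CauchySeq f := by
      rw [Metric.cauchySeq_iff]
      intro ε hε
      obtain ⟨N, hN⟩ := Metric.cauchySeq_iff.1 hsb.cauchySeq ε hε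
      exact ⟨N, fun l hl m hm => (hdist l m).trans_lt (hN l hl m hm)⟩
    obtain ⟨g, hg⟩ := cauchySeq_tendsto_of_complete hcau
    refine ⟨g, fun a => ?_⟩
    have hev : Continuous fun f : ZeroAtInftyContinuousMap (nSpectrum n x) (Mat n) => f a :=
      (continuous_eval_const (F := BoundedContinuousFunction (nSpectrum n x) (Mat n)) a).comp
        ZeroAtInftyContinuousMap.isometry_toBCF.continuous
    have hrep : Continuous (repAt a) := AddMonoidHomClass.continuous_of_bound (repAt a) 1
      (by simpa using NonUnitalStarAlgHom.norm_apply_le (repAt a))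
    refine tendsto_nhds_unique ((hev.tendsto g).comp hg) ?_
    exact ((hrep.tendsto b).comp hsb).congr fun m => (hf m a).symm
  · exact fun j => ⟨(coordProj n x j).1, fun a => (repAt_gen a j).symm⟩
  · rintro b c ⟨f, hf⟩ ⟨g, hg⟩
    exact ⟨f + g, fun a => by rw [ZeroAtInftyContinuousMap.add_apply, hf, hg, map_add]⟩
  · rintro b c ⟨f, hf⟩ ⟨g, hg⟩
    exact ⟨f * g, fun a => by rw [ZeroAtInftyContinuousMap.mul_apply, hf, hg, map_mul]⟩
  · rintro z b ⟨f, hf⟩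
    exact ⟨z • f, fun a => by rw [ZeroAtInftyContinuousMap.smul_apply, hf, map_smul]⟩
  · rintro b ⟨f, hf⟩
    exact ⟨star f, fun a => by rw [ZeroAtInftyContinuousMap.star_apply, hf, map_star]⟩

theorem equivariantC0_ext {f g : equivariantC0 n (nSpectrum n x)} (h : ∀ a, f.1 a = g.1 a) :
    f = g := Subtype.ext (ZeroAtInftyContinuousMap.ext h)

variable (n x) in
/-- The Gelfand transform. -/
def gelfand : generated x →⋆ₙₐ[ℂ] equivariantC0 n (nSpectrum n x) :=
  let F : generated x → equivariantC0 n (nSpectrum n x) := fun b =>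
    ⟨(exists_zeroAtInfty_eq_repAt b).choose, fun u a => by
      rw [(exists_zeroAtInfty_eq_repAt b).choose_spec,
        (exists_zeroAtInfty_eq_repAt b).choose_spec, repAt_smul]⟩
  have hF : ∀ b a, (F b).1 a = repAt a b := fun b => (exists_zeroAtInfty_eq_repAt b).choose_spec
  { toFun := F
    map_smul' := fun z b => equivariantC0_ext fun a => by
      rw [hF, map_smul, ← hF]; rfl
    map_zero' := equivariantC0_ext fun a => by
      rw [hF, map_zero]; rfl
    map_add' := fun b c => equivariantC0_ext fun a => by
      rw [hF, map_add, ← hF, ← hF]; rfl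
    map_mul' := fun b c => equivariantC0_ext fun a => by
      rw [hF, map_mul, ← hF, ← hF]; rfl
    map_star' := fun b => equivariantC0_ext fun a => by
      rw [hF, map_star, ← hF]; rfl }

theorem gelfand_apply (b : generated x) (a : nSpectrum n x) : (gelfand n x b).1 a = repAt a b :=
  (exists_zeroAtInfty_eq_repAt b).choose_spec a

theorem gelfand_gen (j : Fin k) : gelfand n x (gen x j) = coordProj n x j :=
  equivariantC0_ext fun a => by rw [gelfand_apply, repAt_gen]; rfl

/-- A matrix representation not killing `b` is nonzero, so it is `repAt` of a point of the spectrum.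
-/
theorem gelfand_injective (hx : IsHomogeneousSystem n x) : Function.Injective (gelfand n x) := by
  rw [injective_iff_map_eq_zero]
  intro b hb
  by_contra hb0
  obtain ⟨π, hπ⟩ := IsHomogeneous.exists_matrix_rep hx hb0
  let a : nSpectrum n x := ⟨_, π, fun h => hπ (by rw [h]; rfl), rfl⟩
  have ha : repAt a = π := starAlgHom_generated_ext fun j => repAt_gen a j
  apply hπ
  rw [← ha, ← gelfand_apply, hb]
  rfl

theorem gelfand_isometry (hx : IsHomogeneousSystem n x) : Isometry (gelfand n x) :=
  letI : NonUnitalCStarAlgebra (ZeroAtInftyContinuousMap (nSpectrum n x) (Mat n)) := {}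
  NonUnitalStarAlgHom.isometry (gelfand n x) (gelfand_injective hx)

theorem gelfand_surjective (hn : 1 ≤ n) (hx : IsHomogeneousSystem n x) :
    Function.Surjective (gelfand n x) := by
  have hsurj : ∀ a : nSpectrum n x, Function.Surjective (repAt a) := fun a =>
    IsHomogeneous.surjective hn hx (repAt a) (repAt_ne_zero a)
  have hclosed : IsClosed (Set.range (gelfand n x)) :=
    (gelfand_isometry hx).isClosedEmbedding.isClosed_range
  intro f
  suffices f ∈ closure (Set.range (gelfand n x)) by rwa [hclosed.closure_eq] at this
  rw [Metric.mem_closure_iff]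
  intro ε hε
  obtain ⟨b, hb⟩ := exists_uniform_approx (r := fun a : nSpectrum n x => repAt a)
    (fun b => by
      simp only [← gelfand_apply]
      exact (gelfand n x b).1.continuous)
    (fun b => by
      simp only [← gelfand_apply]
      exact (gelfand n x b).1.zero_at_infty')
    f.1.continuous f.1.zero_at_infty'
    (fun a => ⟨hsurj a 1, by
      obtain ⟨b, hb⟩ := hsurj a (f.1 a)
      refine ⟨b, hb, fun c => ?_⟩
      -- If `c` lies in the orbit of `a`, equivariance of `f` makes an interpolant at `a` correct at
      -- `c` too.
      rcases exists_smul_eq_or_exists_separating (repAt a) (repAt c) (hsurj a) (hsurj c) with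
        ⟨u, hu⟩ | h
      · left
        have hc : c = u • a := Subtype.ext <| funext fun j => by
          rw [coe_smul_nSpectrum, ← repAt_gen, ← repAt_gen, hu]
        change repAt c b = f.1 c
        rw [hu, hb, hc]
        exact (f.2 u a).symm
      · exact Or.inr h⟩)
    -- Chosen so that the total error, `1 + n` times this, is `ε / 2`.
    (ε := ε / (2 * (1 + n))) (by positivity)
  refine ⟨_, ⟨b, rfl⟩, ?_⟩
  have h2 : ε / (2 * (1 + n)) + n * (ε / (2 * (1 + n))) = ε / 2 := by
    field_simp
  rw [h2] at hb
  refine lt_of_le_of_lt ?_ (half_lt_self hε)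
  rw [Subtype.dist_eq, ← ZeroAtInftyContinuousMap.isometry_toBCF.dist_eq,
    BoundedContinuousFunction.dist_le (by positivity)]
  intro a
  change dist (f.1 a) ((gelfand n x b).1 a) ≤ _
  rw [dist_eq_norm, gelfand_apply]
  exact hb a

end Gelfand

end NHomogeneous

end

/-! ### Inverting the Gelfand transform. -/

theorem mainTheorem10 {A : Type u} [NonUnitalCStarAlgebra A] {n k : ℕ} (hn : 1 ≤ n)
    (x : Fin k → A) (hx : NHomogeneous.IsHomogeneousSystem n x) :
    (∃! Φ : NHomogeneous.equivariantC0 n (NHomogeneous.nSpectrum n x) →⋆ₙₐ[ℂ]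
        NHomogeneous.generated x,
      ∀ j, Φ (NHomogeneous.coordProj n x j) = NHomogeneous.gen x j) ∧
    ∀ Φ : NHomogeneous.equivariantC0 n (NHomogeneous.nSpectrum n x) →⋆ₙₐ[ℂ]
        NHomogeneous.generated x,
      (∀ j, Φ (NHomogeneous.coordProj n x j) = NHomogeneous.gen x j) →
        Function.Bijective Φ ∧ Isometry Φ := by
  have hbij : Function.Bijective (NHomogeneous.gelfand n x) :=
    ⟨NHomogeneous.gelfand_injective hx, NHomogeneous.gelfand_surjective hn hx⟩
  let G : NHomogeneous.generated x ≃⋆ₐ[ℂ]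
      NHomogeneous.equivariantC0 n (NHomogeneous.nSpectrum n x) :=
    StarAlgEquiv.ofBijective (NHomogeneous.gelfand n x) hbij
  have hG : ∀ b, G b = NHomogeneous.gelfand n x b := fun b => rfl
  -- The composite fixes the generators, hence everything. As `gelfand` is bijective and isometric,
  -- this alone yields uniqueness, bijectivity and isometry of `Φ`.
  have hinv : ∀ Φ : NHomogeneous.equivariantC0 n (NHomogeneous.nSpectrum n x) →⋆ₙₐ[ℂ]
      NHomogeneous.generated x,
      (∀ j, Φ (NHomogeneous.coordProj n x j) = NHomogeneous.gen x j) →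
        ∀ b, Φ (NHomogeneous.gelfand n x b) = b := by
    intro Φ hΦ b
    have : Φ.comp (NHomogeneous.gelfand n x) = NonUnitalStarAlgHom.id ℂ _ :=
      NHomogeneous.starAlgHom_generated_ext fun j => by
        change Φ (NHomogeneous.gelfand n x (NHomogeneous.gen x j)) = NHomogeneous.gen x j
        rw [NHomogeneous.gelfand_gen, hΦ]
    exact DFunLike.congr_fun this b
  refine ⟨⟨(G.symm : _ →⋆ₙₐ[ℂ] NHomogeneous.generated x), fun j => ?_, fun Φ hΦ => ?_⟩,
    fun Φ hΦ => ⟨⟨?_, ?_⟩, ?_⟩⟩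
  · change G.symm _ = _
    rw [← NHomogeneous.gelfand_gen, ← hG, G.symm_apply_apply]
  · ext1 f
    obtain ⟨b, rfl⟩ := hbij.2 f
    rw [hinv Φ hΦ]
    exact (G.symm_apply_apply b).symm
  · intro f g hfg
    obtain ⟨b, rfl⟩ := hbij.2 f
    obtain ⟨c, rfl⟩ := hbij.2 g
    rw [hinv Φ hΦ, hinv Φ hΦ] at hfg
    rw [hfg]
  · exact fun b => ⟨_, hinv Φ hΦ b⟩
  · refine Isometry.of_dist_eq fun f g => ?_
    obtain ⟨b, rfl⟩ := hbij.2 f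
    obtain ⟨c, rfl⟩ := hbij.2 g
    rw [hinv Φ hΦ, hinv Φ hΦ, (NHomogeneous.gelfand_isometry hx).dist_eq]
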